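/- Consider $N$ agents and $H$ hypotheses $\Theta=\{1,\dots,H\}$ with true hypothesis $\theta_0$. Let $A=[a_{\ell k}]$ be a non-negative left-stochastic combination matrix (each column sums to $1$) of a strongly connected network; as is standard, the network is also aperiodic (the lengths of the closed walks along positive weights have greatest common divisor $1$; e.g. some $a_{kk}>0$). Let $\pi$ be the Perron eigenvector of $A$, $A\pi=\pi$, $\mathbb 1^\top\pi=1$, $\pi\succ0$. Agent $k$ observes data $\xi_{k,i}\in\mathcal X_k$, $i=1,2,\dots$, distributed with density $L_k(\cdot\mid\theta_0)$, where $L_k(\cdot\mid\theta)$, $\theta\in\Theta$, are the likelihoods of agent $k$ (probability densities with respect to a $\sigma$-finite measure). The data are i.i.d. over time and independent across agents. With step-size $\delta\in(0,1)$, the beliefs evolve by $$\psi_{k,i}(\theta)=\frac{\mu_{k,i-1}(\theta)^{1-\delta}L_k(\xi_{k,i}\mid\theta)^{\delta}}{\sum_{\theta'}\mu_{k,i-1}(\theta')^{1-\delta}L_k(\xi_{k,i}\mid\theta')^{\delta}},\qquad \mu_{k,i}(\theta)=\frac{\exp\{\sum_\ell a_{\ell k}\log\psi_{\ell,i}(\theta)\}}{\sum_{\theta'}\exp\{\sum_\ell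 a_{\ell k}\log\psi_{\ell,i}(\theta')\}}.$$ Let $x_{k,i}(\theta)=\log\frac{L_k(\xi_{k,i}\mid\theta_0)}{L_k(\xi_{k,i}\mid\theta)}$, $d_k(\theta)=\mathbb E[x_{k,i}(\theta)]$, $\rho_k(\theta,\theta')=\mathrm{Cov}(x_{k,i}(\theta),x_{k,i}(\theta'))$, and for $\theta,\theta'\neq\theta_0$ $$\mathsf m_{\rm ave}(\theta)=\sum_{\ell}\pi_\ell d_\ell(\theta),\qquad \mathsf C_{\rm ave}(\theta,\theta')=\sum_\ell\pi_\ell^2\rho_\ell(\theta,\theta').$$ Assume that the initial beliefs $\mu_{k,0}$ are strictly positive probability vectors; that for all $k$ and $\theta\ne\theta_0$ the Kullback–Leibler divergence of $L_k(\cdot\mid\theta_0)$ from $L_k(\cdot\mid\theta)$, which equals $d_k(\theta)$, is finite; that for each $\theta\neq\theta_0$ there is an agent $k$ with $d_k(\theta)>0$; and that all $x_{k,i}(\theta)$, $\theta\ne\theta_0$, have finite variance. Then, for each agent $k$: 1. for every $\delta\in(0,1)$ the inner series in $$\lambda_k^{(\delta)}(\theta)=\sum_{\ell=1}^N\delta\sum_{m=0}^\infty(1-\delta)^m[A^{m+1}]_{\ell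 k}\,x_{\ell,m+1}(\theta),\qquad\theta\ne\theta_0,$$ converge almost surely (absolutely), and the vector $\lambda_k^{(\delta)}=(\lambda_k^{(\delta)}(\theta))_{\theta\neq\theta_0}$ is the steady state of the log-belief ratios: $\big(\log\frac{\mu_{k,i}(\theta_0)}{\mu_{k,i}(\theta)}\big)_{\theta\ne\theta_0}$ converges in distribution to $\lambda_k^{(\delta)}$ as $i\to\infty$; 2. as $\delta\to0$, $\big(\lambda_k^{(\delta)}-\mathsf m_{\rm ave}\big)/\sqrt\delta$ converges in distribution to the zero-mean multivariate Gaussian with covariance matrix $\mathsf C_{\rm ave}/2$. -/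

import Mathlib

open MeasureTheory ProbabilityTheory Filter Topology

noncomputable section

namespace ASL

/-- Aperiodicity of the weighted directed graph whose edges are the positive entries of the
nonnegative matrix `A`: the only common divisor of the lengths of all closed walks is `1`.
For instance one self-loop `0 < A k k` is enough. -/
def IsAperiodic {N : ℕ} (A : Matrix (Fin N) (Fin N) ℝ) : Prop :=
  ∀ d : ℕ, (∀ (k : Fin N) (n : ℕ), 0 < n → 0 < (A ^ n) k k → d ∣ n) → d = 1

/-- The measure with density `f` with respect to the reference measure `ν`. -/
def law {X : Type*} [MeasurableSpace X] (ν : Measure X) (f : X → ℝ) : Measure X :=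
  ν.withDensity fun ξ => ENNReal.ofReal (f ξ)

/-- The log-likelihood ratio `log (L(ξ|θ₀) / L(ξ|θ))` as a function of the datum `ξ`. -/
def logLik {X : Type*} {H : ℕ} (L : Fin H → X → ℝ) (θ₀ θ : Fin H) (ξ : X) : ℝ :=
  Real.log (L θ₀ ξ / L θ ξ)

/-- The expected log-likelihood ratio `d(θ)`, the datum being distributed according to `θ₀`. -/
def meanLogLik {X : Type*} [MeasurableSpace X] {H : ℕ} (ν : Measure X) (L : Fin H → X → ℝ)
    (θ₀ θ : Fin H) : ℝ :=
  ∫ ξ, logLik L θ₀ θ ξ ∂(law ν (L θ₀))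

/-- The covariance `ρ(θ, θ')` of the log-likelihood ratios at `θ` and `θ'`, the datum being
distributed according to `θ₀`. -/
def covLogLik {X : Type*} [MeasurableSpace X] {H : ℕ} (ν : Measure X) (L : Fin H → X → ℝ)
    (θ₀ θ θ' : Fin H) : ℝ :=
  cov[logLik L θ₀ θ, logLik L θ₀ θ'; law ν (L θ₀)]

/-- The vector `m_ave = (∑ ℓ, π ℓ * d_ℓ(θ))`, `θ ≠ θ₀`. -/
def mAve {N H : ℕ} {X : Fin N → Type*} [∀ k, MeasurableSpace (X k)]
    (ν : ∀ k, Measure (X k)) (L : ∀ k, Fin H → X k → ℝ) (θ₀ : Fin H) (π : Fin N → ℝ) :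
    EuclideanSpace ℝ {θ : Fin H // θ ≠ θ₀} :=
  WithLp.toLp 2 fun θ => ∑ l, π l * meanLogLik (ν l) (L l) θ₀ θ.1

/-- The matrix `C_ave = (∑ ℓ, (π ℓ)² * ρ_ℓ(θ, θ'))`, `θ, θ' ≠ θ₀`. -/
def cAve {N H : ℕ} {X : Fin N → Type*} [∀ k, MeasurableSpace (X k)]
    (ν : ∀ k, Measure (X k)) (L : ∀ k, Fin H → X k → ℝ) (θ₀ : Fin H) (π : Fin N → ℝ) :
    Matrix {θ : Fin H // θ ≠ θ₀} {θ : Fin H // θ ≠ θ₀} ℝ :=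
  Matrix.of fun θ θ' => ∑ l, π l ^ 2 * covLogLik (ν l) (L l) θ₀ θ.1 θ'.1

/-- The adaptive Bayesian update: from the belief vector `μ` of an agent with likelihoods `L`
and its new datum `ξ` to the intermediate belief vector. -/
def adapt {X : Type*} {H : ℕ} (δ : ℝ) (L : Fin H → X → ℝ) (μ : Fin H → ℝ) (ξ : X)
    (θ : Fin H) : ℝ :=
  (μ θ ^ (1 - δ) * L θ ξ ^ δ) / ∑ θ' : Fin H, μ θ' ^ (1 - δ) * L θ' ξ ^ δ

/-- The combination step: agent `k` averages the logarithms of the intermediate beliefs `ψ ℓ`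
with the weights `A ℓ k` (which vanish when `ℓ` is not a neighbor of `k`) and normalizes. -/
def combine {N H : ℕ} (A : Matrix (Fin N) (Fin N) ℝ) (ψ : Fin N → Fin H → ℝ)
    (k : Fin N) (θ : Fin H) : ℝ :=
  Real.exp (∑ l, A l k * Real.log (ψ l θ)) /
    ∑ θ' : Fin H, Real.exp (∑ l, A l k * Real.log (ψ l θ'))

/-- The beliefs after `i` steps of the adaptive social learning algorithm with step-size `δ`,
started from `μ₀`; `obs k i` is the datum that agent `k` observes at time `i + 1`. -/
def belief {N H : ℕ} {X : Fin N → Type*} (A : Matrix (Fin N) (Fin N) ℝ)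
    (L : ∀ k, Fin H → X k → ℝ) (δ : ℝ) (μ₀ : Fin N → Fin H → ℝ) (obs : ∀ k, ℕ → X k) :
    ℕ → Fin N → Fin H → ℝ
  | 0 => μ₀
  | i + 1 => combine A fun l => adapt δ (L l) (belief A L δ μ₀ obs i l) (obs l i)

/-- The vector of log-belief ratios `log (μ_{k,i}(θ₀) / μ_{k,i}(θ))`, `θ ≠ θ₀`, of agent `k` at
time `i`. -/
def logBelief {N H : ℕ} {X : Fin N → Type*} (A : Matrix (Fin N) (Fin N) ℝ)
    (L : ∀ k, Fin H → X k → ℝ) (θ₀ : Fin H) (δ : ℝ) (μ₀ : Fin N → Fin H → ℝ)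
    (obs : ∀ k, ℕ → X k) (k : Fin N) (i : ℕ) : EuclideanSpace ℝ {θ : Fin H // θ ≠ θ₀} :=
  WithLp.toLp 2 fun θ =>
    Real.log (belief A L δ μ₀ obs i k θ₀ / belief A L δ μ₀ obs i k θ.1)

/-- The `m`-th term `(1-δ)^m [A^(m+1)]_{ℓk} x_{ℓ,m+1}(θ)` of the inner series that agent `ℓ`
contributes to the steady-state log-belief ratio of agent `k` at `θ`. -/
def steadyTerm {N H : ℕ} {X : Fin N → Type*} (A : Matrix (Fin N) (Fin N) ℝ)
    (L : ∀ k, Fin H → X k → ℝ) (θ₀ : Fin H) (δ : ℝ) (obs : ∀ k, ℕ → X k) (k : Fin N)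
    (θ : Fin H) (l : Fin N) (m : ℕ) : ℝ :=
  (1 - δ) ^ m * (A ^ (m + 1)) l k * logLik (L l) θ₀ θ (obs l m)

/-- The steady-state vector of log-belief ratios of agent `k`, as the series
`∑ ℓ, δ ∑ m, (1-δ)^m [A^(m+1)]_{ℓk} x_{ℓ,m+1}(θ)`, `θ ≠ θ₀`. -/
def steadyLogBelief {N H : ℕ} {X : Fin N → Type*} (A : Matrix (Fin N) (Fin N) ℝ)
    (L : ∀ k, Fin H → X k → ℝ) (θ₀ : Fin H) (δ : ℝ) (obs : ∀ k, ℕ → X k) (k : Fin N) :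
    EuclideanSpace ℝ {θ : Fin H // θ ≠ θ₀} :=
  WithLp.toLp 2 fun θ => ∑ l, δ * ∑' m, steadyTerm A L θ₀ δ obs k θ.1 l m

end ASL

end

/-!
The log-belief ratios obey the linear recursion `w_{i+1} = Aᵀ ((1-δ) w_i + δ x_i)`. Since the data
are i.i.d. over time, reversing time does not change the law of its solution, and the reversed
solution converges almost surely to the steady-state series. The powers `A^m` converge summably fast
to `π 1ᵀ` (some power of `A` is positive, hence a contraction on zero-sum vectors), so the steady
state is within `O(δ)` of the series `∑ m, δ (1-δ)^m z_m` in the i.i.d. vectors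
`z_m = ∑ ℓ, π_ℓ x_{ℓ,m+1}`. A central limit theorem for weighted series applies to the latter; the
factor `1/2` in the covariance is the limit of `δ ∑ m, ((1-δ)^2)^m = 1 / (2-δ)`.
-/

namespace ASL

section PositivePowers

variable {n R : Type*} [Fintype n] [DecidableEq n] [Ring R] [LinearOrder R] [IsOrderedRing R]
  [PosMulStrictMono R] {A : Matrix n n R}

theorem pow_add_apply_pos (hA : ∀ i j, 0 ≤ A i j) {a b : ℕ} {i j l : n}
    (hij : 0 < (A ^ a) i j) (hjl : 0 < (A ^ b) j l) : 0 < (A ^ (a + b)) i l := by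
  rw [pow_add, Matrix.mul_apply]
  exact Finset.sum_pos' (fun x _ => mul_nonneg (Matrix.pow_apply_nonneg hA a i x)
    (Matrix.pow_apply_nonneg hA b x l)) ⟨j, Finset.mem_univ j, mul_pos hij hjl⟩

variable [Nontrivial R]

theorem setGcd_pow_apply_self_pos_dvd (hA : A.IsIrreducible) (k : n) {j : n} {a : ℕ}
    (ha : 0 < (A ^ a) j j) : Nat.setGcd {m | 0 < (A ^ m) k k} ∣ a := by
  have hconn := (Matrix.isIrreducible_iff_exists_pow_pos hA.nonneg).1 hA
  obtain ⟨p, -, hp⟩ := hconn k j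
  obtain ⟨q, -, hq⟩ := hconn j k
  have hshort : Nat.setGcd {m | 0 < (A ^ m) k k} ∣ p + q :=
    Nat.setGcd_dvd_of_mem (pow_add_apply_pos hA.nonneg hp hq)
  have hlong : Nat.setGcd {m | 0 < (A ^ m) k k} ∣ p + a + q :=
    Nat.setGcd_dvd_of_mem
      (pow_add_apply_pos hA.nonneg (pow_add_apply_pos hA.nonneg hp ha) hq)
  rw [add_right_comm] at hlong
  exact (Nat.dvd_add_right hshort).1 hlong

theorem eventually_pow_apply_self_pos (hA : ∀ i j, 0 ≤ A i j) {k : n}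
    (hk : Nat.setGcd {m | 0 < (A ^ m) k k} = 1) : ∀ᶠ m in atTop, 0 < (A ^ m) k k := by
  obtain ⟨m₀, hm₀⟩ := Nat.exists_mem_closure_of_ge {m | 0 < (A ^ m) k k}
  filter_upwards [eventually_ge_atTop m₀] with m hm
  have hmem := hm₀ m hm (hk ▸ one_dvd m)
  clear hm
  induction hmem using AddSubmonoid.closure_induction with
  | mem _ ha => exact ha
  | zero => simp only [pow_zero, Matrix.one_apply_eq, zero_lt_one]
  | add _ _ _ _ ha hb => exact pow_add_apply_pos hA ha hb

theorem isPrimitive_of_setGcd_eq_one (hA : A.IsIrreducible)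
    (hgcd : ∀ k, Nat.setGcd {m | 0 < (A ^ m) k k} = 1) : A.IsPrimitive := by
  have hpos : ∀ i j, ∀ᶠ m in atTop, 0 < (A ^ m) i j := fun i j => by
    obtain ⟨p, -, hp⟩ := (Matrix.isIrreducible_iff_exists_pow_pos hA.nonneg).1 hA i j
    filter_upwards [(tendsto_sub_atTop_nat p).eventually
      (eventually_pow_apply_self_pos hA.nonneg (hgcd j)), eventually_ge_atTop p] with m hm hpm
    exact Nat.add_sub_cancel' hpm ▸ pow_add_apply_pos hA.nonneg hp hm
  obtain ⟨m, hm, hm0⟩ := ((eventually_all.2 fun i => eventually_all.2 (hpos i)).and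
    (eventually_gt_atTop 0)).exists
  exact ⟨hA.nonneg, m, hm0, hm⟩

theorem IsAperiodic.isPrimitive {N : ℕ} {A : Matrix (Fin N) (Fin N) ℝ} (hper : IsAperiodic A)
    (hA : A.IsIrreducible) : A.IsPrimitive :=
  isPrimitive_of_setGcd_eq_one hA fun k =>
    hper _ fun _ _ _ ha => setGcd_pow_apply_self_pos_dvd hA k ha

end PositivePowers

section Perron

variable {n : Type*} [Fintype n] [DecidableEq n] {A : Matrix n n ℝ} {π : n → ℝ}

open scoped Matrix

theorem pow_mulVec_eq_self {R : Type*} [Semiring R] {A : Matrix n n R} {v : n → R}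
    (hv : A *ᵥ v = v) (m : ℕ) : A ^ m *ᵥ v = v := by
  induction m with
  | zero => simp
  | succ m ih => rw [pow_succ, ← Matrix.mulVec_mulVec, hv, ih]

/-- Doeblin's contraction: since `v` has zero sum, `ε` may be subtracted from all entries of the
matrix without changing the product. -/
theorem sum_abs_mulVec_le_of_sum_eq_zero {ε : ℝ} (hA : A ∈ Matrix.colStochastic ℝ n)
    (hε : ∀ i j, ε ≤ A i j) {v : n → ℝ} (hv : ∑ i, v i = 0) :
    ∑ i, |(A *ᵥ v) i| ≤ (1 - Fintype.card n * ε) * ∑ i, |v i| := by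
  have hshift : ∀ i, (A *ᵥ v) i = ∑ j, (A i j - ε) * v j := fun i => by
    simp_rw [sub_mul, Finset.sum_sub_distrib, ← Finset.mul_sum, hv, mul_zero, sub_zero,
      Matrix.mulVec, dotProduct]
  calc ∑ i, |(A *ᵥ v) i| ≤ ∑ i, ∑ j, (A i j - ε) * |v j| := by
        refine Finset.sum_le_sum fun i _ => ?_
        rw [hshift]
        refine (Finset.abs_sum_le_sum_abs _ _).trans_eq (Finset.sum_congr rfl fun j _ => ?_)
        rw [abs_mul, abs_of_nonneg (sub_nonneg.2 (hε i j))]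
    _ = (1 - Fintype.card n * ε) * ∑ i, |v i| := by
        rw [Finset.sum_comm, Finset.mul_sum]
        refine Finset.sum_congr rfl fun j _ => ?_
        rw [← Finset.sum_mul, Finset.sum_sub_distrib, Matrix.sum_col_of_mem_colStochastic hA,
          Finset.sum_const, Finset.card_univ, nsmul_eq_mul]

theorem summable_of_add_le_mul {u : ℕ → ℝ} (hu : ∀ m, 0 ≤ u m) {c : ℝ} (hc : c < 1) {p : ℕ}
    (h : ∀ m, u (m + p) ≤ c * u m) : Summable u := by
  refine summable_of_sum_range_le (c := (∑ m ∈ Finset.range p, u m) / (1 - c)) hu fun M => ?_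
  rw [le_div_iff₀ (sub_pos.2 hc)]
  have hstep : ∑ m ∈ Finset.range M, u m
      ≤ ∑ m ∈ Finset.range p, u m + c * ∑ m ∈ Finset.range M, u m :=
    calc ∑ m ∈ Finset.range M, u m ≤ ∑ m ∈ Finset.range (p + M), u m :=
          Finset.sum_le_sum_of_subset_of_nonneg (Finset.range_subset_range.2 (by omega))
            fun _ _ _ => hu _
      _ ≤ _ := by
          rw [Finset.sum_range_add, Finset.mul_sum]
          gcongr with m
          exact add_comm p m ▸ h m
  linarith

theorem summable_sum_abs_pow_sub (hprim : A.IsPrimitive) (hA : A ∈ Matrix.colStochastic ℝ n)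
    (hπ : A *ᵥ π = π) (hπ_sum : ∑ l, π l = 1) (k : n) :
    Summable fun m => ∑ l, |(A ^ m) l k - π l| := by
  obtain ⟨p, -, hpos⟩ := hprim.exists_pos_pow
  obtain ⟨⟨i₀, j₀⟩, -, hmin⟩ := Finset.exists_min_image Finset.univ
    (fun q : n × n => (A ^ p) q.1 q.2) ⟨(k, k), Finset.mem_univ _⟩
  have hcard : (0 : ℝ) < Fintype.card n := Nat.cast_pos.2 (Fintype.card_pos_iff.2 ⟨k⟩)
  refine summable_of_add_le_mul (p := p) (fun m => Finset.sum_nonneg fun _ _ => abs_nonneg _)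
    (sub_lt_self 1 (mul_pos hcard (hpos i₀ j₀))) fun m => ?_
  have hzero : ∑ l, ((A ^ m).col k - π) l = 0 := by
    simp only [Pi.sub_apply, Matrix.col_apply, Finset.sum_sub_distrib, hπ_sum,
      Matrix.sum_col_of_mem_colStochastic (pow_mem hA m), sub_self]
  have hstep : A ^ p *ᵥ ((A ^ m).col k - π) = (A ^ (m + p)).col k - π := by
    rw [Matrix.mulVec_sub, pow_mulVec_eq_self hπ, add_comm, pow_add]
    rfl
  simpa only [hstep, Pi.sub_apply, Matrix.col_apply] using
    sum_abs_mulVec_le_of_sum_eq_zero (pow_mem hA p) (fun i j => hmin (i, j) (Finset.mem_univ _))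
      hzero

theorem summable_pow_apply_sub (hprim : A.IsPrimitive) (hA : A ∈ Matrix.colStochastic ℝ n)
    (hπ : A *ᵥ π = π) (hπ_sum : ∑ l, π l = 1) (l k : n) :
    Summable fun m => (A ^ m) l k - π l :=
  .of_norm_bounded (summable_sum_abs_pow_sub hprim hA hπ hπ_sum k) fun m =>
    Finset.single_le_sum (f := fun l => |(A ^ m) l k - π l|) (fun _ _ => abs_nonneg _)
      (Finset.mem_univ l)

end Perron

section Convergence

variable {Ω Ω' ι E : Type*} [MeasurableSpace Ω] [MeasurableSpace Ω'] {P : Measure Ω}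
  [NormedAddCommGroup E]

theorem tendstoInMeasure_zero_of_ae_norm_le [IsFiniteMeasure P] {F : Filter ι}
    [F.IsCountablyGenerated] {X : ι → Ω → E} (hX : ∀ i, AEStronglyMeasurable (X i) P)
    {a : ι → ℝ} (ha : Tendsto a F (𝓝 0)) {R : Ω → ℝ} (h : ∀ i, ∀ᵐ ω ∂P, ‖X i ω‖ ≤ a i * R ω) :
    TendstoInMeasure P X F 0 := by
  refine fun ε hε => tendsto_of_seq_tendsto fun u hu => ?_
  refine tendstoInMeasure_of_tendsto_ae (g := 0) (fun m => hX (u m)) ?_ ε hε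
  filter_upwards [ae_all_iff.2 fun m => h (u m)] with ω hω
  exact squeeze_zero_norm hω (by simpa using (ha.comp hu).mul_const (R ω))

variable [MeasurableSpace E] [BorelSpace E]

theorem ae_summable_norm_smul [NormedSpace ℝ E] {Y : ℕ → Ω → E}
    (hid : ∀ m, IdentDistrib (Y m) (Y 0) P P) (hY : Integrable (Y 0) P) {c : ℕ → ℝ}
    (hc : Summable c) : ∀ᵐ ω ∂P, Summable fun m => ‖c m • Y m ω‖ := by
  have hYm : ∀ m, Integrable (Y m) P := fun m => (hid m).integrable_iff.2 hY
  have hnorm : ∀ m, eLpNorm (c m • Y m) 1 P = ‖c m‖ₑ * eLpNorm (Y 0) 1 P := fun m => by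
    rw [eLpNorm_const_smul, (hid m).eLpNorm_eq]
  refine summable_norm_of_tsum_eLpNorm_ne_top (p := 1) le_rfl (f := fun m => c m • Y m)
    (fun m => (hYm m).1.const_smul (c m)) ?_
  simp_rw [hnorm, ENNReal.tsum_mul_right]
  exact ENNReal.mul_ne_top (tsum_enorm_ne_top_iff_summable_norm.2 hc.norm)
    (memLp_one_iff_integrable.2 hY).eLpNorm_ne_top

theorem aemeasurable_of_hasSum [SecondCountableTopology E] {Y : ℕ → Ω → E} {S : Ω → E}
    (hY : ∀ m, AEMeasurable (Y m) P) (hS : ∀ᵐ ω ∂P, HasSum (fun m => Y m ω) (S ω)) :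
    AEMeasurable S P :=
  aemeasurable_of_tendsto_metrizable_ae' (fun _ => Finset.aemeasurable_fun_sum _ fun m _ => hY m)
    (hS.mono fun _ hω => hω.tendsto_sum_nat)

theorem tendstoInDistribution_of_identDistrib [IsProbabilityMeasure P] {P' : Measure Ω'}
    [IsProbabilityMeasure P'] {F : Filter ι} {X Y : ι → Ω → E} {Z : Ω' → E}
    (h : TendstoInDistribution X F Z (fun _ => P) P') (hXY : ∀ i, IdentDistrib (X i) (Y i) P P) :
    TendstoInDistribution Y F Z (fun _ => P) P' where
  forall_aemeasurable i := (hXY i).aemeasurable_snd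
  aemeasurable_limit := h.aemeasurable_limit
  tendsto := h.tendsto.congr fun i => Subtype.ext (hXY i).map_eq

end Convergence

section TimeReversal

variable {Ω S E : Type*} [MeasurableSpace Ω] {P : Measure Ω} [MeasurableSpace S]
  [MeasurableSpace E] {V : ℕ → Ω → S} {f : ℕ → S → E}

theorem identDistrib_sum_reverse [AddCommMonoid E] [MeasurableAdd₂ E] (hind : iIndepFun V P)
    (hid : ∀ m, IdentDistrib (V m) (V 0) P P) (hf : ∀ m, Measurable (f m)) (i : ℕ) :
    IdentDistrib (fun ω => ∑ m ∈ Finset.range i, f m (V m ω))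
      (fun ω => ∑ m ∈ Finset.range i, f m (V (i - 1 - m) ω)) P P := by
  have hforward : iIndepFun (fun m : Fin i => V m) P := hind.precomp Fin.val_injective
  have hbackward : iIndepFun (fun m : Fin i => V (i - 1 - m)) P :=
    hind.precomp (g := fun m : Fin i => i - 1 - (m : ℕ)) fun a b (hab : i - 1 - a = i - 1 - b) =>
      Fin.ext (by omega)
  have hpath := IdentDistrib.pi (fun m : Fin i => (hid m).trans (hid (i - 1 - m)).symm)
    hforward hbackward
  simp_rw [Finset.sum_range]
  exact hpath.comp (u := fun v : Fin i → S => ∑ m : Fin i, f m (v m))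
    (Finset.measurable_fun_sum _ fun m _ => (hf m).comp (measurable_pi_apply m))

theorem tendstoInDistribution_sum_reverse [IsProbabilityMeasure P] [NormedAddCommGroup E]
    [SecondCountableTopology E] [BorelSpace E] (hind : iIndepFun V P)
    (hid : ∀ m, IdentDistrib (V m) (V 0) P P) (hf : ∀ m, Measurable (f m)) {Y : Ω → E}
    (hY : ∀ᵐ ω ∂P, Tendsto (fun i => ∑ m ∈ Finset.range i, f m (V m ω)) atTop (𝓝 (Y ω))) :
    TendstoInDistribution (fun (i : ℕ) ω => ∑ m ∈ Finset.range i, f m (V (i - 1 - m) ω)) atTop Y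
      (fun _ => P) P := by
  have hmeas : ∀ i, AEMeasurable (fun ω => ∑ m ∈ Finset.range i, f m (V m ω)) P := fun i =>
    Finset.aemeasurable_fun_sum _ fun m _ => (hf m).comp_aemeasurable (hid m).aemeasurable_fst
  exact tendstoInDistribution_of_identDistrib
    (tendstoInDistribution_of_ae_tendsto hmeas (aemeasurable_of_tendsto_metrizable_ae' hmeas hY) hY)
    (identDistrib_sum_reverse hind hid hf)

end TimeReversal

section CentralLimit

theorem norm_prod_sub_prod_le_sum {ι R : Type*} [NormedCommRing R] [NormOneClass R]
    (s : Finset ι) {f g : ι → R} (hf : ∀ i ∈ s, ‖f i‖ ≤ 1) (hg : ∀ i ∈ s, ‖g i‖ ≤ 1) :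
    ‖∏ i ∈ s, f i - ∏ i ∈ s, g i‖ ≤ ∑ i ∈ s, ‖f i - g i‖ := by
  induction s using Finset.cons_induction with
  | empty => simp
  | cons a s ha ih =>
    have hfs : ‖∏ i ∈ s, f i‖ ≤ 1 := (s.norm_prod_le f).trans
      (Finset.prod_le_one (fun _ _ => norm_nonneg _) fun i hi => hf i (Finset.mem_cons_of_mem hi))
    have htail := ih (fun i hi => hf i (Finset.mem_cons_of_mem hi))
      fun i hi => hg i (Finset.mem_cons_of_mem hi)
    simp_rw [Finset.prod_cons, Finset.sum_cons]
    calc ‖f a * ∏ i ∈ s, f i - g a * ∏ i ∈ s, g i‖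
        = ‖(f a - g a) * ∏ i ∈ s, f i + g a * (∏ i ∈ s, f i - ∏ i ∈ s, g i)‖ := by ring_nf
      _ ≤ ‖f a - g a‖ * ‖∏ i ∈ s, f i‖ + ‖g a‖ * ‖∏ i ∈ s, f i - ∏ i ∈ s, g i‖ :=
          (norm_add_le _ _).trans (add_le_add (norm_mul_le _ _) (norm_mul_le _ _))
      _ ≤ ‖f a - g a‖ + ∑ i ∈ s, ‖f i - g i‖ :=
          add_le_add (mul_le_of_le_one_right (norm_nonneg _) hfs)
            ((mul_le_of_le_one_left (norm_nonneg _) (hg a (Finset.mem_cons_self a s))).trans htail)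

variable {E : Type*} [NormedAddCommGroup E] [InnerProductSpace ℝ E] [FiniteDimensional ℝ E]
  [MeasurableSpace E] [BorelSpace E] {μ : Measure E}

theorem charFun_smul_eq_charFun_map_inner (s : ℝ) (t : E) :
    charFun μ (s • t) = charFun (μ.map fun x => inner ℝ t x) s := by
  rw [charFun_apply, charFun_apply_real, integral_map (by fun_prop) (by fun_prop)]
  simp_rw [real_inner_smul_right, real_inner_comm t, Complex.ofReal_mul]

theorem cexp_neg_mul_sq_sub_isLittleO (v : ℝ) :
    (fun s : ℝ => Complex.exp ((-(v * s ^ 2 / 2) : ℝ) : ℂ) - (1 - ((v * s ^ 2 / 2 : ℝ) : ℂ)))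
      =o[𝓝 0] fun s : ℝ => s ^ 2 := by
  have hexp : (fun x : ℂ => Complex.exp x - 1 - x) =o[𝓝 0] fun x => x := by
    simpa using (Complex.hasDerivAt_exp 0).isLittleO
  have hlim : Tendsto (fun s : ℝ => ((-(v * s ^ 2 / 2) : ℝ) : ℂ)) (𝓝 0) (𝓝 0) :=
    Continuous.tendsto' (by fun_prop) _ _ (by simp)
  have hbigO : (fun s : ℝ => ((-(v * s ^ 2 / 2) : ℝ) : ℂ)) =O[𝓝 0] fun s : ℝ => s ^ 2 :=
    .of_bound (|v| / 2) (.of_forall fun s => by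
      rw [Complex.norm_real, norm_neg, norm_div, norm_mul, Real.norm_two, Real.norm_eq_abs v]
      exact le_of_eq (by ring))
  refine ((hexp.comp_tendsto hlim).trans_isBigO hbigO).congr_left fun s => ?_
  simp only [Function.comp_apply, Complex.ofReal_neg]
  ring

theorem charFun_smul_sub_cexp_isLittleO [IsProbabilityMeasure μ] (hμ : MemLp id 2 μ)
    (hμ0 : ∫ x, x ∂μ = 0) (t : E) :
    (fun s : ℝ => charFun μ (s • t)
        - Complex.exp ((-(covarianceBilin μ t t * s ^ 2 / 2) : ℝ) : ℂ))
      =o[𝓝 0] fun s : ℝ => s ^ 2 := by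
  have hcomplete : CompleteSpace E := FiniteDimensional.complete ℝ E
  set X : E → ℝ := fun x => inner ℝ t x
  have hX : AEMeasurable X μ := by fun_prop
  have hXL : MemLp id 2 (μ.map X) := (memLp_map_measure_iff (by fun_prop) hX).2 (hμ.const_inner t)
  have hX0 : ∫ x, X x ∂μ = 0 := by
    refine (integral_inner (hμ.integrable one_le_two) t).trans ?_
    simp only [id_eq, hμ0, inner_zero_right]
  have : IsProbabilityMeasure (μ.map X) := Measure.isProbabilityMeasure_map hX
  have htaylor : (fun s : ℝ => charFun μ (s • t)
      - (1 - ((covarianceBilin μ t t * s ^ 2 / 2 : ℝ) : ℂ))) =o[𝓝 0] fun s : ℝ => s ^ 2 := by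
    refine ((taylor_isLittleO_univ (x₀ := 0) (n := 2)
      (contDiff_charFun hXL)).congr_left fun s => ?_).congr_right fun s => (by rw [sub_zero])
    rw [taylorWithinEval_charFun_two_zero hX hXL, hX0, covarianceBilin_self hμ,
      variance_of_integral_eq_zero hX hX0, charFun_smul_eq_charFun_map_inner]
    push_cast
    simp only [Pi.pow_apply]
    ring
  refine (htaylor.sub (cexp_neg_mul_sq_sub_isLittleO (covarianceBilin μ t t))).congr_left
    fun s => ?_
  ring

variable {Ω : Type*} [MeasurableSpace Ω] {P : Measure Ω} [IsProbabilityMeasure P] {z : ℕ → Ω → E}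

theorem tendsto_prod_charFun_smul (hind : iIndepFun z P) (hz : ∀ m, HasLaw (z m) μ P)
    {s : ℕ → ℝ} {Y : Ω → E} (hY : ∀ᵐ ω ∂P, HasSum (fun m => s m • z m ω) (Y ω)) (t : E) :
    Tendsto (fun n => ∏ m ∈ Finset.range n, charFun μ (s m • t)) atTop
      (𝓝 (charFun (P.map Y) t)) := by
  have hmeas : ∀ m, AEMeasurable (fun ω => s m • z m ω) P := fun m =>
    (hz m).aemeasurable.const_smul (s m)
  have hsum : ∀ n, AEMeasurable (fun ω => ∑ m ∈ Finset.range n, s m • z m ω) P := fun n =>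
    Finset.aemeasurable_fun_sum _ fun m _ => hmeas m
  have hind' : iIndepFun (fun m ω => s m • z m ω) P :=
    hind.comp (fun m x => s m • x) fun m => by fun_prop
  have hprod : ∀ n, charFun (P.map fun ω => ∑ m ∈ Finset.range n, s m • z m ω) t
      = ∏ m ∈ Finset.range n, charFun μ (s m • t) := fun n => by
    rw [(hind'.restrict _).charFun_map_fun_finsetSum_eq_prod fun m _ => hmeas m, Finset.prod_apply]
    exact Finset.prod_congr rfl fun m _ => by
      rw [charFun_map_smul_comp (hz m).aemeasurable, (hz m).map_eq]
  have hpartial : ∀ᵐ ω ∂P, Tendsto (fun n => ∑ m ∈ Finset.range n, s m • z m ω) atTop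
      (𝓝 (Y ω)) := hY.mono fun ω hω => hω.tendsto_sum_nat
  have hlim := tendstoInDistribution_of_ae_tendsto hsum
    (aemeasurable_of_tendsto_metrizable_ae' hsum hpartial) hpartial
  exact (ProbabilityMeasure.tendsto_iff_tendsto_charFun.1 hlim.tendsto t).congr hprod

variable [IsProbabilityMeasure μ]

theorem norm_charFun_sub_cexp_le (hind : iIndepFun z P) (hz : ∀ m, HasLaw (z m) μ P)
    {s : ℕ → ℝ} {σ : ℝ} (hs : HasSum (fun m => s m ^ 2) σ) {Y : Ω → E}
    (hY : ∀ᵐ ω ∂P, HasSum (fun m => s m • z m ω) (Y ω)) {t : E} {v ε : ℝ} (hv : 0 ≤ v)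
    (h : ∀ m, ‖charFun μ (s m • t) - Complex.exp ((-(v * s m ^ 2 / 2) : ℝ) : ℂ)‖ ≤ ε * s m ^ 2) :
    ‖charFun (P.map Y) t - Complex.exp ((-(v * σ / 2) : ℝ) : ℂ)‖ ≤ ε * σ := by
  have hgauss : Tendsto
      (fun n => ∏ m ∈ Finset.range n, Complex.exp ((-(v * s m ^ 2 / 2) : ℝ) : ℂ)) atTop
      (𝓝 (Complex.exp ((-(v * σ / 2) : ℝ) : ℂ))) := by
    simp_rw [← Complex.exp_sum, ← Complex.ofReal_sum]
    exact (Complex.continuous_exp.comp Complex.continuous_ofReal).continuousAt.tendsto.comp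
      (((hs.mul_left v).div_const 2).neg.tendsto_sum_nat)
  refine le_of_tendsto_of_tendsto' ((tendsto_prod_charFun_smul hind hz hY t).sub hgauss).norm
    (hs.mul_left ε).tendsto_sum_nat fun n => ?_
  refine (norm_prod_sub_prod_le_sum _ (fun m _ => norm_charFun_le_one _) fun m _ => ?_).trans
    (Finset.sum_le_sum fun m _ => h m)
  rw [Complex.norm_exp_ofReal, Real.exp_le_one_iff]
  exact neg_nonpos.2 (by positivity)

variable {ι : Type*} {F : Filter ι} {s : ι → ℕ → ℝ} {b σ : ι → ℝ} {c : ℝ} {Y : ι → Ω → E}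

theorem tendsto_charFun_of_hasSum_smul (hind : iIndepFun z P) (hz : ∀ m, HasLaw (z m) μ P)
    (hμ : MemLp id 2 μ) (hμ0 : ∫ x, x ∂μ = 0) (hsb : ∀ i m, |s i m| ≤ b i)
    (hb : Tendsto b F (𝓝 0)) (hs : ∀ i, HasSum (fun m => s i m ^ 2) (σ i))
    (hσ : Tendsto σ F (𝓝 c)) (hY : ∀ i, ∀ᵐ ω ∂P, HasSum (fun m => s i m • z m ω) (Y i ω)) (t : E) :
    Tendsto (fun i => charFun (P.map (Y i)) t) F
      (𝓝 (Complex.exp ((-(covarianceBilin μ t t * c / 2) : ℝ) : ℂ))) := by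
  have hgauss : Tendsto (fun i => Complex.exp ((-(covarianceBilin μ t t * σ i / 2) : ℝ) : ℂ)) F
      (𝓝 (Complex.exp ((-(covarianceBilin μ t t * c / 2) : ℝ) : ℂ))) :=
    (Complex.continuous_exp.comp Complex.continuous_ofReal).continuousAt.tendsto.comp
      ((hσ.const_mul _).div_const 2).neg
  have hdiff : (fun i => charFun (P.map (Y i)) t
      - Complex.exp ((-(covarianceBilin μ t t * σ i / 2) : ℝ) : ℂ)) =o[F] σ := by
    refine Asymptotics.isLittleO_iff.2 fun ε hε => ?_
    obtain ⟨r, hr, hlocal⟩ :=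
      Metric.eventually_nhds_iff.1 ((charFun_smul_sub_cexp_isLittleO hμ hμ0 t).def hε)
    filter_upwards [hb.eventually_lt_const hr] with i hi
    rw [Real.norm_of_nonneg ((hs i).nonneg fun m => sq_nonneg _)]
    refine norm_charFun_sub_cexp_le hind hz (hs i) (hY i) (covarianceBilin_self_nonneg t)
      fun m => ?_
    have hsmall : dist (s i m) 0 < r := by
      rw [Real.dist_0_eq_abs]
      exact (hsb i m).trans_lt hi
    simpa only [Real.norm_of_nonneg (sq_nonneg (s i m))] using hlocal hsmall
  simpa only [sub_add_cancel, zero_add] using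
    ((hdiff.trans_isBigO (hσ.isBigO_one ℝ)).tendsto_zero_of_tendsto tendsto_const_nhds).add hgauss

theorem tendstoInDistribution_of_hasSum_smul [F.IsCountablyGenerated] (hind : iIndepFun z P)
    (hz : ∀ m, HasLaw (z m) μ P) (hμ : MemLp id 2 μ) (hμ0 : ∫ x, x ∂μ = 0)
    (hsb : ∀ i m, |s i m| ≤ b i) (hb : Tendsto b F (𝓝 0))
    (hs : ∀ i, HasSum (fun m => s i m ^ 2) (σ i)) (hσ : Tendsto σ F (𝓝 c))
    (hY : ∀ i, ∀ᵐ ω ∂P, HasSum (fun m => s i m • z m ω) (Y i ω))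
    {G : Measure E} [IsGaussian G] (hG0 : ∫ x, x ∂G = 0)
    (hG : covarianceBilin G = c • covarianceBilin μ) :
    TendstoInDistribution Y F id (fun _ => P) G where
  forall_aemeasurable i :=
    aemeasurable_of_hasSum (fun m => (hz m).aemeasurable.const_smul (s i m)) (hY i)
  aemeasurable_limit := aemeasurable_id
  tendsto := by
    have hcomplete : CompleteSpace E := FiniteDimensional.complete ℝ E
    refine tendsto_of_seq_tendsto fun u hu =>
      ProbabilityMeasure.tendsto_iff_tendsto_charFun.2 fun t => ?_
    have hlimit : charFun (G.map id) t
        = Complex.exp ((-(covarianceBilin μ t t * c / 2) : ℝ) : ℂ) := by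
      rw [Measure.map_id, IsGaussian.charFun_eq', hG]
      simp only [id_eq, hG0, inner_zero_right, smul_apply, smul_eq_mul]
      push_cast
      ring_nf
    exact hlimit ▸ (tendsto_charFun_of_hasSum_smul hind hz hμ hμ0 hsb hb hs hσ hY t).comp hu

end CentralLimit

section AbelMean

/-- The weights `δ (1 - δ)^m` of the Abel mean `∑ m, δ (1 - δ)^m y_m` of a sequence `y`. -/
def abelWeight (δ : ℝ) (m : ℕ) : ℝ := δ * (1 - δ) ^ m

variable {δ : ℝ}

theorem abelWeight_nonneg (hδ : δ ∈ Set.Ioo (0 : ℝ) 1) (m : ℕ) : 0 ≤ abelWeight δ m :=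
  mul_nonneg hδ.1.le (pow_nonneg (sub_nonneg.2 hδ.2.le) m)

theorem abelWeight_le (hδ : δ ∈ Set.Ioo (0 : ℝ) 1) (m : ℕ) : abelWeight δ m ≤ δ :=
  mul_le_of_le_one_right hδ.1.le
    (pow_le_one₀ (sub_nonneg.2 hδ.2.le) (sub_le_self _ hδ.1.le))

theorem hasSum_abelWeight (hδ : δ ∈ Set.Ioo (0 : ℝ) 1) : HasSum (abelWeight δ) 1 := by
  have hgeom := (hasSum_geometric_of_lt_one (sub_nonneg.2 hδ.2.le)
    (sub_lt_self 1 hδ.1)).mul_left δ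
  rwa [sub_sub_cancel, mul_inv_cancel₀ hδ.1.ne'] at hgeom

theorem inv_sqrt_mul_abelWeight_sq (hδ : 0 < δ) (m : ℕ) :
    ((√δ)⁻¹ * abelWeight δ m) ^ 2 = δ * ((1 - δ) ^ 2) ^ m := by
  rw [abelWeight, mul_pow, inv_pow, Real.sq_sqrt hδ.le, mul_pow, ← pow_mul, ← pow_mul, mul_comm m]
  field_simp

theorem hasSum_inv_sqrt_mul_abelWeight_sq (hδ : δ ∈ Set.Ioo (0 : ℝ) 1) :
    HasSum (fun m => ((√δ)⁻¹ * abelWeight δ m) ^ 2) (2 - δ)⁻¹ := by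
  simp_rw [inv_sqrt_mul_abelWeight_sq hδ.1]
  have hgeom := (hasSum_geometric_of_lt_one (sq_nonneg (1 - δ))
    (pow_lt_one₀ (sub_nonneg.2 hδ.2.le) (sub_lt_self 1 hδ.1) two_ne_zero)).mul_left δ
  have hratio : δ * (1 - (1 - δ) ^ 2)⁻¹ = (2 - δ)⁻¹ := by
    rw [show 1 - (1 - δ) ^ 2 = δ * (2 - δ) by ring, mul_inv, mul_inv_cancel_left₀ hδ.1.ne']
  rwa [hratio] at hgeom

theorem inv_sqrt_mul_abelWeight_le (hδ : δ ∈ Set.Ioo (0 : ℝ) 1) (m : ℕ) :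
    |(√δ)⁻¹ * abelWeight δ m| ≤ √δ := by
  rw [abs_of_nonneg (mul_nonneg (inv_nonneg.2 (Real.sqrt_nonneg δ)) (abelWeight_nonneg hδ m)),
    inv_mul_le_iff₀ (Real.sqrt_pos.2 hδ.1), Real.mul_self_sqrt hδ.1.le]
  exact abelWeight_le hδ m

theorem norm_sub_le_of_hasSum_abelWeight_smul {E : Type*} [NormedAddCommGroup E] [NormedSpace ℝ E]
    (hδ : δ ∈ Set.Ioo (0 : ℝ) 1) {y z : ℕ → E} {a b : E}
    (hy : HasSum (fun m => abelWeight δ m • y m) a) (hz : HasSum (fun m => abelWeight δ m • z m) b)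
    (hyz : Summable fun m => ‖y m - z m‖) : ‖a - b‖ ≤ δ * ∑' m, ‖y m - z m‖ := by
  refine (hy.sub hz).norm_le_of_bounded (hyz.hasSum.mul_left δ) fun m => ?_
  rw [← smul_sub, norm_smul, Real.norm_of_nonneg (abelWeight_nonneg hδ m)]
  exact mul_le_mul_of_nonneg_right (abelWeight_le hδ m) (norm_nonneg _)

variable {E : Type*} [NormedAddCommGroup E] [InnerProductSpace ℝ E] [FiniteDimensional ℝ E]
  [MeasurableSpace E] [BorelSpace E] {μ : Measure E} [IsProbabilityMeasure μ]
  {Ω : Type*} [MeasurableSpace Ω] {P : Measure Ω} [IsProbabilityMeasure P] {z : ℕ → Ω → E}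
  {ι : Type*} {F : Filter ι} [F.IsCountablyGenerated] {δ : ι → ℝ} {G : Measure E} [IsGaussian G]

theorem tendstoInDistribution_abelMean_of_iIndepFun (hind : iIndepFun z P)
    (hz : ∀ m, HasLaw (z m) μ P) (hμ : MemLp id 2 μ) (hδ : ∀ i, δ i ∈ Set.Ioo (0 : ℝ) 1)
    (hδ0 : Tendsto δ F (𝓝 0)) {Z : ι → Ω → E}
    (hZ : ∀ i, ∀ᵐ ω ∂P, HasSum (fun m => abelWeight (δ i) m • z m ω) (Z i ω))
    (hG0 : ∫ x, x ∂G = 0) (hG : covarianceBilin G = (2⁻¹ : ℝ) • covarianceBilin μ) :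
    TendstoInDistribution (fun i ω => (√(δ i))⁻¹ • (Z i ω - ∫ x, x ∂μ)) F id (fun _ => P) G := by
  have hcomplete : CompleteSpace E := FiniteDimensional.complete ℝ E
  set a : E := ∫ x, x ∂μ
  set μ₀ : Measure E := μ.map fun x => -a + x
  have hprob : IsProbabilityMeasure μ₀ := Measure.isProbabilityMeasure_map (by fun_prop)
  have hμ₀ : MemLp id 2 μ₀ :=
    (memLp_map_measure_iff (by fun_prop) (by fun_prop)).2 ((memLp_const (-a)).add hμ)
  have hmean : ∫ x, x ∂μ₀ = 0 := by
    rw [integral_map (by fun_prop) (by fun_prop)]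
    refine (integral_add (integrable_const (-a)) (hμ.integrable one_le_two)).trans ?_
    rw [integral_const, probReal_univ, one_smul]
    exact neg_add_cancel a
  have hlaw : ∀ m, HasLaw (fun ω => -a + z m ω) μ₀ P := fun m =>
    ((measurable_const_add (-a)).measurePreserving μ).fun_comp_hasLaw (hz m)
  have hσ : Tendsto (fun i => (2 - δ i)⁻¹) F (𝓝 2⁻¹) := by
    simpa only [sub_zero] using (tendsto_const_nhds.sub hδ0).inv₀ (by norm_num)
  have hb : Tendsto (fun i => √(δ i)) F (𝓝 0) := by
    simpa only [Real.sqrt_zero] using hδ0.sqrt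
  refine tendstoInDistribution_of_hasSum_smul (z := fun m ω => -a + z m ω) (μ := μ₀)
    (hind.comp (fun _ x => -a + x) fun _ => by fun_prop) hlaw hμ₀ hmean
    (fun i => inv_sqrt_mul_abelWeight_le (hδ i)) hb
    (fun i => hasSum_inv_sqrt_mul_abelWeight_sq (hδ i)) hσ (fun i => ?_) hG0
    (by rw [hG, covarianceBilin_map_const_add])
  filter_upwards [hZ i] with ω hω
  have hcentered := (((hasSum_abelWeight (hδ i)).smul_const (-a)).add hω).const_smul (√(δ i))⁻¹
  rw [one_smul, neg_add_eq_sub] at hcentered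
  simpa only [← smul_add, smul_smul] using hcentered

theorem tendstoInDistribution_abelMean (hind : iIndepFun z P) (hz : ∀ m, HasLaw (z m) μ P)
    (hμ : MemLp id 2 μ) (hδ : ∀ i, δ i ∈ Set.Ioo (0 : ℝ) 1) (hδ0 : Tendsto δ F (𝓝 0))
    {y : ℕ → Ω → E} (hy : ∀ m, AEMeasurable (y m) P)
    (hyz : ∀ᵐ ω ∂P, Summable fun m => ‖y m ω - z m ω‖) {Y : ι → Ω → E}
    (hY : ∀ i, ∀ᵐ ω ∂P, HasSum (fun m => abelWeight (δ i) m • y m ω) (Y i ω))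
    (hG0 : ∫ x, x ∂G = 0) (hG : covarianceBilin G = (2⁻¹ : ℝ) • covarianceBilin μ) :
    TendstoInDistribution (fun i ω => (√(δ i))⁻¹ • (Y i ω - ∫ x, x ∂μ)) F id (fun _ => P) G := by
  have hcomplete : CompleteSpace E := FiniteDimensional.complete ℝ E
  have hint : Integrable (z 0) P :=
    (((hz 0).map_eq.symm ▸ hμ).comp_of_map (hz 0).aemeasurable).integrable one_le_two
  set Z : ι → Ω → E := fun i ω => ∑' m, abelWeight (δ i) m • z m ω
  have hZ : ∀ i, ∀ᵐ ω ∂P, HasSum (fun m => abelWeight (δ i) m • z m ω) (Z i ω) := fun i => by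
    filter_upwards [ae_summable_norm_smul (fun m => (hz m).identDistrib (hz 0)) hint
      (hasSum_abelWeight (hδ i)).summable] with ω hω
    exact hω.of_norm.hasSum
  have hYm : ∀ i, AEMeasurable (Y i) P := fun i =>
    aemeasurable_of_hasSum (fun m => (hy m).const_smul (abelWeight (δ i) m)) (hY i)
  have hZm : ∀ i, AEMeasurable (Z i) P := fun i =>
    aemeasurable_of_hasSum (fun m => (hz m).aemeasurable.const_smul (abelWeight (δ i) m)) (hZ i)
  refine tendstoInDistribution_of_tendstoInMeasure_sub _ _
    (tendstoInDistribution_abelMean_of_iIndepFun hind hz hμ hδ hδ0 hZ hG0 hG) ?_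
    fun i => ((hYm i).sub_const _).const_smul _
  refine tendstoInMeasure_zero_of_ae_norm_le (a := fun i => √(δ i))
    (R := fun ω => ∑' m, ‖y m ω - z m ω‖) (fun i => ?_)
    (by simpa only [Real.sqrt_zero] using hδ0.sqrt) fun i => ?_
  · exact (((hYm i).sub_const _).const_smul _ |>.sub
      (((hZm i).sub_const _).const_smul _)).aestronglyMeasurable
  · filter_upwards [hY i, hZ i, hyz] with ω hYω hZω hyzω
    have hclose := norm_sub_le_of_hasSum_abelWeight_smul (hδ i) hYω hZω hyzω
    rw [Pi.sub_apply, Pi.sub_apply, ← smul_sub, sub_sub_sub_cancel_right, norm_smul, norm_inv,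
      Real.norm_of_nonneg (Real.sqrt_nonneg _), inv_mul_le_iff₀ (Real.sqrt_pos.2 (hδ i).1),
      ← mul_assoc, Real.mul_self_sqrt (hδ i).1.le]
    exact hclose

end AbelMean

theorem eq_pow_smul_add_sum {M V : Type*} [Monoid M] [AddCommMonoid V] [DistribMulAction M V]
    {T : M} {w u : ℕ → V} (h : ∀ i, w (i + 1) = T • w i + u i) (i : ℕ) :
    w i = T ^ i • w 0 + ∑ m ∈ Finset.range i, T ^ m • u (i - 1 - m) := by
  induction i with
  | zero => simp
  | succ i ih =>
    rw [h, ih, Finset.sum_range_succ']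
    simp only [smul_add, Finset.smul_sum, smul_smul, ← pow_succ', Nat.add_sub_cancel,
      Nat.sub_sub, add_comm 1, pow_zero, one_smul, tsub_zero, add_assoc]

theorem tendsto_pow_smul_sum_col {E : Type*} [NormedAddCommGroup E] [NormedSpace ℝ E] {N : ℕ}
    {A : Matrix (Fin N) (Fin N) ℝ} {δ : ℝ}
    (hA : A ∈ Matrix.colStochastic ℝ (Fin N)) (hδ : δ ∈ Set.Ioo (0 : ℝ) 1) (w : Fin N → E)
    (k : Fin N) : Tendsto (fun i => (1 - δ) ^ i • ∑ l, (A ^ i) l k • w l) atTop (𝓝 0) := by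
  have hgeom := tendsto_pow_atTop_nhds_zero_of_lt_one (sub_nonneg.2 hδ.2.le) (sub_lt_self 1 hδ.1)
  refine squeeze_zero_norm (a := fun i => (1 - δ) ^ i * ∑ l, ‖w l‖) (fun i => ?_)
    (by simpa only [zero_mul] using hgeom.mul_const (∑ l, ‖w l‖))
  have hAi : A ^ i ∈ Matrix.colStochastic ℝ (Fin N) := pow_mem hA i
  rw [norm_smul, Real.norm_of_nonneg (pow_nonneg (sub_nonneg.2 hδ.2.le) i)]
  refine mul_le_mul_of_nonneg_left (norm_sum_le_of_le _ fun l _ => ?_)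
    (pow_nonneg (sub_nonneg.2 hδ.2.le) i)
  rw [norm_smul, Real.norm_of_nonneg (Matrix.nonneg_of_mem_colStochastic hAi)]
  exact mul_le_of_le_one_left (norm_nonneg _) (Matrix.le_one_of_mem_colStochastic hAi)

/-- The vector of log-likelihood ratios `log (L(ξ|θ₀) / L(ξ|θ))`, `θ ≠ θ₀`. -/
noncomputable def logLikVec {X : Type*} {H : ℕ} (L : Fin H → X → ℝ) (θ₀ : Fin H) (ξ : X) :
    EuclideanSpace ℝ {θ : Fin H // θ ≠ θ₀} :=
  WithLp.toLp 2 fun θ => logLik L θ₀ θ.1 ξ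

/-- The vector `∑ ℓ, a ℓ * log (L_ℓ(ξ_ℓ|θ₀) / L_ℓ(ξ_ℓ|θ))`, `θ ≠ θ₀`, that pools the data `v` of
all agents with the weights `a`. In the algorithm, `a` is a column of a power of the combination
matrix; in the limit, it is the Perron eigenvector. -/
noncomputable def pooledLogLik {N H : ℕ} {X : Fin N → Type*} (a : Fin N → ℝ)
    (L : ∀ k, Fin H → X k → ℝ) (θ₀ : Fin H) (v : ∀ k, X k) :
    EuclideanSpace ℝ {θ : Fin H // θ ≠ θ₀} :=
  ∑ l, a l • logLikVec (L l) θ₀ (v l)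

theorem pooledLogLik_apply {N H : ℕ} {X : Fin N → Type*} {L : ∀ k, Fin H → X k → ℝ} {θ₀ : Fin H}
    (a : Fin N → ℝ) (v : ∀ k, X k) (θ : {θ : Fin H // θ ≠ θ₀}) :
    pooledLogLik a L θ₀ v θ = ∑ l, a l * logLik (L l) θ₀ θ (v l) := by
  simp [pooledLogLik, logLikVec]

section Recursion

variable {N H : ℕ}

theorem combine_pos (A : Matrix (Fin N) (Fin N) ℝ) (ψ : Fin N → Fin H → ℝ)
    (k : Fin N) (θ : Fin H) : 0 < combine A ψ k θ :=
  div_pos (Real.exp_pos _) (Finset.sum_pos (fun _ _ => Real.exp_pos _) ⟨θ, Finset.mem_univ θ⟩)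

theorem log_combine_div (A : Matrix (Fin N) (Fin N) ℝ) (ψ : Fin N → Fin H → ℝ)
    (k : Fin N) (θ₀ θ : Fin H) :
    Real.log (combine A ψ k θ₀ / combine A ψ k θ)
      = ∑ l, A l k * (Real.log (ψ l θ₀) - Real.log (ψ l θ)) := by
  have hS : (∑ θ' : Fin H, Real.exp (∑ l, A l k * Real.log (ψ l θ'))) ≠ 0 :=
    (Finset.sum_pos (fun _ _ => Real.exp_pos _) ⟨θ, Finset.mem_univ θ⟩).ne'
  rw [combine, combine, div_div_div_cancel_right₀ hS, ← Real.exp_sub, Real.log_exp,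
    ← Finset.sum_sub_distrib]
  simp_rw [mul_sub]

theorem log_adapt_sub {X : Type*} {δ : ℝ} {L : Fin H → X → ℝ} {μ : Fin H → ℝ} {ξ : X}
    (hμ : ∀ θ, 0 < μ θ) (hL : ∀ θ, 0 < L θ ξ) (θ₀ θ : Fin H) :
    Real.log (adapt δ L μ ξ θ₀) - Real.log (adapt δ L μ ξ θ)
      = (1 - δ) * Real.log (μ θ₀ / μ θ) + δ * logLik L θ₀ θ ξ := by
  have hp : ∀ θ, 0 < μ θ ^ (1 - δ) * L θ ξ ^ δ := fun θ =>
    mul_pos (Real.rpow_pos_of_pos (hμ θ) _) (Real.rpow_pos_of_pos (hL θ) _)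
  have hS : 0 < ∑ θ' : Fin H, μ θ' ^ (1 - δ) * L θ' ξ ^ δ :=
    Finset.sum_pos (fun θ _ => hp θ) ⟨θ, Finset.mem_univ θ⟩
  have h : ∀ θ, Real.log (adapt δ L μ ξ θ) = (1 - δ) * Real.log (μ θ) + δ * Real.log (L θ ξ)
      - Real.log (∑ θ' : Fin H, μ θ' ^ (1 - δ) * L θ' ξ ^ δ) := fun θ => by
    rw [adapt, Real.log_div (hp θ).ne' hS.ne',
      Real.log_mul (Real.rpow_pos_of_pos (hμ θ) _).ne' (Real.rpow_pos_of_pos (hL θ) _).ne',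
      Real.log_rpow (hμ θ), Real.log_rpow (hL θ)]
  rw [h, h, logLik, Real.log_div (hμ _).ne' (hμ _).ne', Real.log_div (hL _).ne' (hL _).ne']
  ring

variable {X : Fin N → Type*} (A : Matrix (Fin N) (Fin N) ℝ) {L : ∀ k, Fin H → X k → ℝ}
  {μ₀ : Fin N → Fin H → ℝ} {obs : ∀ k, ℕ → X k} (δ : ℝ)

theorem belief_pos (hμ₀ : ∀ k θ, 0 < μ₀ k θ) (i : ℕ) (k : Fin N) (θ : Fin H) :
    0 < belief A L δ μ₀ obs i k θ := by
  cases i with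
  | zero => exact hμ₀ k θ
  | succ i => exact combine_pos _ _ _ _

theorem logBelief_succ (hμ₀ : ∀ k θ, 0 < μ₀ k θ) (hL : ∀ k i θ, 0 < L k θ (obs k i))
    (θ₀ : Fin H) (k : Fin N) (i : ℕ) :
    logBelief A L θ₀ δ μ₀ obs k (i + 1) = ∑ l, A l k •
      ((1 - δ) • logBelief A L θ₀ δ μ₀ obs l i + δ • logLikVec (L l) θ₀ (obs l i)) := by
  ext θ
  simp only [logBelief, belief, log_combine_div]
  simp [log_adapt_sub (belief_pos A δ hμ₀ i _) (hL _ i), logLikVec, mul_add]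

open scoped Matrix.Module in
theorem logBelief_eq (hμ₀ : ∀ k θ, 0 < μ₀ k θ) (hL : ∀ k i θ, 0 < L k θ (obs k i))
    (θ₀ : Fin H) (k : Fin N) (i : ℕ) :
    logBelief A L θ₀ δ μ₀ obs k i
      = (1 - δ) ^ i • ∑ l, (A ^ i) l k • logBelief A L θ₀ δ μ₀ obs l 0
        + ∑ m ∈ Finset.range i,
          abelWeight δ m • pooledLogLik ((A ^ (m + 1)).col k) L θ₀ fun l => obs l (i - 1 - m) := by
  have hrec : ∀ i, (logBelief A L θ₀ δ μ₀ obs · (i + 1))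
      = ((1 - δ) • A.transpose) • (logBelief A L θ₀ δ μ₀ obs · i)
        + (δ • A.transpose) • fun l => logLikVec (L l) θ₀ (obs l i) := fun i => by
    ext1 k
    simp only [logBelief_succ A δ hμ₀ hL, smul_assoc, Pi.add_apply, Pi.smul_apply,
      Matrix.Module.smul_apply, Matrix.transpose_apply, smul_add, Finset.sum_add_distrib,
      Finset.smul_sum, smul_comm (A _ k)]
  have hpow : ∀ m (x : Fin N → EuclideanSpace ℝ {θ : Fin H // θ ≠ θ₀}),
      ((1 - δ) • A.transpose) ^ m • (δ • A.transpose) • x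
        = abelWeight δ m • (A ^ (m + 1)).transpose • x := fun m x => by
    rw [smul_smul, smul_pow, smul_mul_smul_comm, ← pow_succ, Matrix.transpose_pow, smul_assoc,
      abelWeight, mul_comm]
  have h := congrFun (eq_pow_smul_add_sum (w := fun i k => logBelief A L θ₀ δ μ₀ obs k i) hrec i) k
  simp only [hpow] at h
  simpa only [smul_pow, ← Matrix.transpose_pow, smul_assoc, Pi.add_apply, Pi.smul_apply,
    Finset.sum_apply, Matrix.Module.smul_apply, Matrix.transpose_apply,
    pooledLogLik, Matrix.col_apply] using h

theorem measurable_logBelief_zero {Ω : Type*} [MeasurableSpace Ω] {μ₀ : Ω → Fin N → Fin H → ℝ}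
    (hμ₀ : Measurable μ₀) {obs : Ω → ∀ k, ℕ → X k} (θ₀ : Fin H) (k : Fin N) :
    Measurable fun ω => logBelief A L θ₀ δ (μ₀ ω) (obs ω) k 0 := by
  have hcoord : ∀ θ, Measurable fun ω => μ₀ ω k θ := fun θ =>
    (measurable_pi_apply θ).comp ((measurable_pi_apply k).comp hμ₀)
  exact (WithLp.measurable_toLp 2 _).comp <| measurable_pi_lambda _ fun θ =>
    Real.measurable_log.comp ((hcoord θ₀).div (hcoord θ))

theorem hasSum_steadyLogBelief {A : Matrix (Fin N) (Fin N) ℝ} {δ : ℝ} {θ₀ : Fin H} {k : Fin N}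
    (h : ∀ θ, θ ≠ θ₀ → ∀ l, Summable (steadyTerm A L θ₀ δ obs k θ l)) :
    HasSum (fun m => abelWeight δ m • pooledLogLik ((A ^ (m + 1)).col k) L θ₀ fun l => obs l m)
      (steadyLogBelief A L θ₀ δ obs k) := by
  suffices hcoord : ∀ θ : {θ : Fin H // θ ≠ θ₀}, HasSum
      (fun m => abelWeight δ m * pooledLogLik ((A ^ (m + 1)).col k) L θ₀ (fun l => obs l m) θ)
      (steadyLogBelief A L θ₀ δ obs k θ) from
    (Pi.hasSum.2 hcoord).mapL (PiLp.continuousLinearEquiv 2 ℝ _).symm.toContinuousLinearMap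
  intro θ
  have hsum := hasSum_sum (s := Finset.univ) fun l _ => (h θ θ.2 l).hasSum.mul_left δ
  simpa only [pooledLogLik_apply, Matrix.col_apply, abelWeight, steadyTerm, steadyLogBelief,
    Finset.mul_sum, mul_assoc] using hsum

end Recursion

theorem covarianceBilin_multivariateGaussian_smul {ι Ω : Type*} [Fintype ι] [DecidableEq ι]
    [MeasurableSpace Ω] {P : Measure Ω} [IsFiniteMeasure P] {Z : Ω → EuclideanSpace ℝ ι}
    (hZ : MemLp Z 2 P) {C : Matrix ι ι ℝ}
    (hC : ∀ i j, cov[fun ω => Z ω i, fun ω => Z ω j; P] = C i j) {c : ℝ} (hc : 0 ≤ c)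
    (a : EuclideanSpace ℝ ι) :
    covarianceBilin (multivariateGaussian a (c • C)) = c • covarianceBilin (P.map Z) := by
  have hbilin : ∀ x y, covarianceBilin (P.map Z) x y = x.ofLp ⬝ᵥ C.mulVec y.ofLp := fun x y => by
    refine (covarianceBilin_apply_pi (fun i => memLp_piLp_iff.1 hZ i) x y).trans ?_
    simp only [hC, dotProduct, Matrix.mulVec, Finset.mul_sum, mul_assoc, mul_comm (y _)]
  have hpos : C.PosSemidef := by
    refine Matrix.PosSemidef.of_dotProduct_mulVec_nonneg ?_ fun x => ?_
    · ext i j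
      simp only [Matrix.conjTranspose_apply, star_trivial, ← hC, covariance_comm]
    · rw [star_trivial, ← WithLp.ofLp_toLp 2 x, ← hbilin]
      exact covarianceBilin_self_nonneg _
  ext x y
  rw [covarianceBilin_multivariateGaussian (hpos.smul hc)]
  simp only [_root_.smul_apply, hbilin, Matrix.smul_mulVec, dotProduct_smul]

section Data

variable {N H : ℕ} {X : Fin N → Type*} [∀ k, MeasurableSpace (X k)] {L : ∀ k, Fin H → X k → ℝ}
  {θ₀ : Fin H}

theorem measurable_logLikVec {X : Type*} [MeasurableSpace X] {L : Fin H → X → ℝ}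
    (hL : ∀ θ, Measurable (L θ)) : Measurable (logLikVec L θ₀) :=
  (WithLp.measurable_toLp 2 _).comp <| measurable_pi_lambda _ fun θ =>
    Real.measurable_log.comp ((hL θ₀).div (hL θ.1))

theorem measurable_pooledLogLik (hL : ∀ k θ, Measurable (L k θ)) (a : Fin N → ℝ) :
    Measurable (pooledLogLik a L θ₀) :=
  Finset.measurable_fun_sum _ fun l _ =>
    ((measurable_logLikVec (hL l)).comp (measurable_pi_apply l)).const_smul (a l)

variable {ν : ∀ k, Measure (X k)} {Ω : Type*} [MeasurableSpace Ω] {P : Measure Ω}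

theorem ae_law_pos {X : Type*} [MeasurableSpace X] (ν : Measure X) {f : X → ℝ}
    (hf : Measurable f) : ∀ᵐ x ∂(law ν f), 0 < f x := by
  rw [law, ae_withDensity_iff hf.ennreal_ofReal]
  refine Eventually.of_forall fun x hx => ?_
  by_contra h
  exact hx (ENNReal.ofReal_of_nonpos (not_lt.1 h))

section Moments

variable {ζ : ∀ k, Ω → X k} (hζ : ∀ k, HasLaw (ζ k) (law (ν k) (L k θ₀)) P)
  (hvar : ∀ k θ, θ ≠ θ₀ → MemLp (logLik (L k) θ₀ θ) 2 (law (ν k) (L k θ₀)))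

include hζ hvar

theorem memLp_logLik_comp (l : Fin N) {θ : Fin H} (hθ : θ ≠ θ₀) :
    MemLp (fun ω => logLik (L l) θ₀ θ (ζ l ω)) 2 P :=
  ((hζ l).map_eq.symm ▸ hvar l θ hθ).comp_of_map (hζ l).aemeasurable

theorem memLp_pooledLogLik (a : Fin N → ℝ) :
    MemLp (fun ω => pooledLogLik a L θ₀ fun l => ζ l ω) 2 P :=
  memLp_piLp_iff.2 fun θ => by
    simp only [pooledLogLik_apply]
    exact memLp_finsetSum _ fun l _ => (memLp_logLik_comp hζ hvar l θ.2).const_mul (a l)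

variable [IsProbabilityMeasure P]

theorem integral_pooledLogLik (a : Fin N → ℝ) :
    ∫ ω, pooledLogLik a L θ₀ (fun l => ζ l ω) ∂P = mAve ν L θ₀ a := by
  ext θ
  have hint : ∀ l, Integrable (fun ω => a l * logLik (L l) θ₀ θ (ζ l ω)) P := fun l =>
    ((memLp_logLik_comp hζ hvar l θ.2).integrable one_le_two).const_mul (a l)
  rw [eval_integral_piLp fun θ =>
    (memLp_piLp_iff.1 (memLp_pooledLogLik hζ hvar a) θ).integrable one_le_two]
  simp only [pooledLogLik_apply]
  rw [integral_finsetSum _ fun l _ => hint l]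
  refine Finset.sum_congr rfl fun l _ => ?_
  rw [integral_const_mul, meanLogLik,
    ← (hζ l).integral_comp (hvar l θ θ.2).aestronglyMeasurable]
  rfl

theorem covariance_pooledLogLik (hind : iIndepFun ζ P)
    (a : Fin N → ℝ) (θ θ' : {θ : Fin H // θ ≠ θ₀}) :
    cov[fun ω => pooledLogLik a L θ₀ (fun l => ζ l ω) θ,
      fun ω => pooledLogLik a L θ₀ (fun l => ζ l ω) θ'; P] = cAve ν L θ₀ a θ θ' := by
  have hLp : ∀ l (θ : {θ : Fin H // θ ≠ θ₀}),
      MemLp (fun ω => a l * logLik (L l) θ₀ θ (ζ l ω)) 2 P := fun l θ =>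
    (memLp_logLik_comp hζ hvar l θ.2).const_mul (a l)
  have hm : ∀ l (θ : {θ : Fin H // θ ≠ θ₀}),
      AEMeasurable (logLik (L l) θ₀ θ) (law (ν l) (L l θ₀)) := fun l θ =>
    (hvar l θ θ.2).aestronglyMeasurable.aemeasurable
  simp only [pooledLogLik_apply]
  rw [covariance_fun_sum_fun_sum (fun l => hLp l θ) (fun l => hLp l θ'), cAve, Matrix.of_apply]
  refine Finset.sum_congr rfl fun l _ => ?_
  rw [Finset.sum_eq_single_of_mem l (Finset.mem_univ l) fun l' _ hl' => ?_]
  · rw [covariance_const_mul_left, covariance_const_mul_right, covLogLik,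
      ← (hζ l).covariance_fun_comp (hm l θ) (hm l θ'), sq, mul_assoc]
  · have hpair : IndepFun (fun ω => logLik (L l) θ₀ θ (ζ l ω))
        (fun ω => logLik (L l') θ₀ θ' (ζ l' ω)) P :=
      (hind.indepFun hl'.symm).comp₀ (hζ l).aemeasurable (hζ l').aemeasurable
        (φ := logLik (L l) θ₀ θ) (ψ := logLik (L l') θ₀ θ')
        ((hζ l).map_eq.symm ▸ hm l θ) ((hζ l').map_eq.symm ▸ hm l' θ')
    rw [covariance_const_mul_left, covariance_const_mul_right,
      hpair.covariance_eq_zero (memLp_logLik_comp hζ hvar l θ.2)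
        (memLp_logLik_comp hζ hvar l' θ'.2), mul_zero, mul_zero]

end Moments

section Dynamics

variable {ξ : ∀ k, ℕ → Ω → X k} {A : Matrix (Fin N) (Fin N) ℝ} {δ : ℝ}

theorem ae_likelihood_pos (hL : ∀ k θ, Measurable (L k θ))
    (hξ : ∀ k i, HasLaw (ξ k i) (law (ν k) (L k θ₀)) P)
    (hac : ∀ k θ, θ ≠ θ₀ → law (ν k) (L k θ₀) ≪ law (ν k) (L k θ)) :
    ∀ᵐ ω ∂P, ∀ k i θ, 0 < L k θ (ξ k i ω) := by
  simp only [ae_all_iff]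
  intro k i θ
  have hpos : ∀ᵐ x ∂law (ν k) (L k θ₀), 0 < L k θ x := by
    rcases eq_or_ne θ θ₀ with rfl | hθ
    · exact ae_law_pos (ν k) (hL k θ)
    · exact (hac k θ hθ).ae_le (ae_law_pos (ν k) (hL k θ))
  rw [← (hξ k i).map_eq] at hpos
  exact ae_of_ae_map (hξ k i).aemeasurable hpos

variable (hξ : ∀ k i, HasLaw (ξ k i) (law (ν k) (L k θ₀)) P)

include hξ

theorem ae_summable_steadyTerm (hA : A ∈ Matrix.colStochastic ℝ (Fin N))
    (hδ : δ ∈ Set.Ioo (0 : ℝ) 1) {l : Fin N} {θ : Fin H}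
    (hint : Integrable (logLik (L l) θ₀ θ) (law (ν l) (L l θ₀))) (k : Fin N) :
    ∀ᵐ ω ∂P, Summable (steadyTerm A L θ₀ δ (fun j i => ξ j i ω) k θ l) := by
  have hlaw : ∀ m, HasLaw (fun ω => logLik (L l) θ₀ θ (ξ l m ω)) _ P := fun m =>
    HasLaw.fun_comp ⟨hint.aestronglyMeasurable.aemeasurable, rfl⟩ (hξ l m)
  have hq : 0 ≤ 1 - δ := sub_nonneg.2 hδ.2.le
  have hcoef : Summable fun m : ℕ => (1 - δ) ^ m * (A ^ (m + 1)) l k :=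
    (summable_geometric_of_lt_one hq (sub_lt_self 1 hδ.1)).of_nonneg_of_le
      (fun m => mul_nonneg (pow_nonneg hq m)
        (Matrix.nonneg_of_mem_colStochastic (pow_mem hA (m + 1))))
      fun m => mul_le_of_le_one_right (pow_nonneg hq m)
        (Matrix.le_one_of_mem_colStochastic (pow_mem hA (m + 1)))
  have hint0 : Integrable (fun ω => logLik (L l) θ₀ θ (ξ l 0 ω)) P :=
    ((hξ l 0).map_eq.symm ▸ hint).comp_aemeasurable (hξ l 0).aemeasurable
  filter_upwards [ae_summable_norm_smul (fun m => (hlaw m).identDistrib (hlaw 0)) hint0 hcoef]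
    with ω hω
  exact hω.of_norm

variable [IsProbabilityMeasure P]
  (hvar : ∀ k θ, θ ≠ θ₀ → MemLp (logLik (L k) θ₀ θ) 2 (law (ν k) (L k θ₀)))

include hvar

theorem ae_hasSum_steadyLogBelief (hA : A ∈ Matrix.colStochastic ℝ (Fin N))
    (hδ : δ ∈ Set.Ioo (0 : ℝ) 1) (k : Fin N) :
    ∀ᵐ ω ∂P, HasSum
      (fun m => abelWeight δ m • pooledLogLik ((A ^ (m + 1)).col k) L θ₀ fun l => ξ l m ω)
      (steadyLogBelief A L θ₀ δ (fun j i => ξ j i ω) k) := by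
  have hprob : ∀ l, IsProbabilityMeasure (law (ν l) (L l θ₀)) := fun l =>
    (hξ l 0).isProbabilityMeasure_iff.1 inferInstance
  have hsum : ∀ᵐ ω ∂P, ∀ θ, θ ≠ θ₀ → ∀ l,
      Summable (steadyTerm A L θ₀ δ (fun j i => ξ j i ω) k θ l) := by
    simp only [ae_all_iff]
    exact fun θ hθ l => ae_summable_steadyTerm hξ hA hδ ((hvar l θ hθ).integrable one_le_two) k
  filter_upwards [hsum] with ω hω using hasSum_steadyLogBelief hω

theorem ae_summable_norm_pooledLogLik_sub (hL : ∀ k θ, Measurable (L k θ))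
    {a : ℕ → Fin N → ℝ} {b : Fin N → ℝ} (hab : ∀ l, Summable fun m => a m l - b l) :
    ∀ᵐ ω ∂P, Summable fun m => ‖pooledLogLik (a m) L θ₀ (fun l => ξ l m ω)
      - pooledLogLik b L θ₀ (fun l => ξ l m ω)‖ := by
  have hlaw : ∀ l m, HasLaw (fun ω => logLikVec (L l) θ₀ (ξ l m ω)) _ P := fun l m =>
    HasLaw.fun_comp ⟨(measurable_logLikVec (hL l)).aemeasurable, rfl⟩ (hξ l m)
  have hint : ∀ l, Integrable (fun ω => logLikVec (L l) θ₀ (ξ l 0 ω)) P := fun l =>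
    (memLp_piLp_iff.2 fun θ => memLp_logLik_comp (fun k => hξ k 0) hvar l θ.2).integrable
      one_le_two
  filter_upwards [ae_all_iff.2 fun l => ae_summable_norm_smul
    (fun m => (hlaw l m).identDistrib (hlaw l 0)) (hint l) (hab l)] with ω hω
  refine (summable_sum (s := Finset.univ) fun l _ => hω l).of_nonneg_of_le
    (fun _ => norm_nonneg _) fun m => ?_
  simp only [pooledLogLik, ← Finset.sum_sub_distrib, ← sub_smul]
  exact norm_sum_le _ _

variable (htime : iIndepFun (fun (i : ℕ) ω (k : Fin N) => ξ k i ω) P)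
  (hagents : ∀ i, iIndepFun (fun k => ξ k i) P)

include htime hagents

theorem tendstoInDistribution_logBelief (hA : A ∈ Matrix.colStochastic ℝ (Fin N))
    (hL : ∀ k θ, Measurable (L k θ))
    (hac : ∀ k θ, θ ≠ θ₀ → law (ν k) (L k θ₀) ≪ law (ν k) (L k θ))
    {μ₀ : Ω → Fin N → Fin H → ℝ} (hμ₀ : Measurable μ₀) (hμ₀_pos : ∀ ω k θ, 0 < μ₀ ω k θ)
    (hδ : δ ∈ Set.Ioo (0 : ℝ) 1) (k : Fin N) :
    TendstoInDistribution
      (fun (i : ℕ) ω => logBelief A L θ₀ δ (μ₀ ω) (fun j i => ξ j i ω) k i) atTop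
      (fun ω => steadyLogBelief A L θ₀ δ (fun j i => ξ j i ω) k) (fun _ => P) P := by
  have hid : ∀ i, IdentDistrib (fun ω l => ξ l i ω) (fun ω l => ξ l 0 ω) P P := fun i =>
    IdentDistrib.pi (fun l => (hξ l i).identDistrib (hξ l 0)) (hagents i) (hagents 0)
  have hreversed := tendstoInDistribution_sum_reverse htime hid
    (fun m => (measurable_pooledLogLik hL ((A ^ (m + 1)).col k)).const_smul (abelWeight δ m))
    ((ae_hasSum_steadyLogBelief hξ hvar hA hδ k).mono fun _ hω => hω.tendsto_sum_nat)
  have hinit : ∀ i, Measurable fun ω => (1 - δ) ^ i •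
      ∑ l, (A ^ i) l k • logBelief A L θ₀ δ (μ₀ ω) (fun j i => ξ j i ω) l 0 := fun i =>
    (Finset.measurable_fun_sum _ fun l _ =>
      (measurable_logBelief_zero A δ hμ₀ θ₀ l).const_smul ((A ^ i) l k)).const_smul ((1 - δ) ^ i)
  have hsum := tendstoInDistribution_of_tendstoInMeasure_sub _ _ hreversed
    (tendstoInMeasure_of_tendsto_ae (fun i => ((hinit i).aemeasurable.add
      (hreversed.forall_aemeasurable i) |>.sub
      (hreversed.forall_aemeasurable i)).aestronglyMeasurable)
      (.of_forall fun ω => by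
        simpa only [Pi.sub_apply, Pi.add_apply, Pi.zero_apply, add_sub_cancel_right]
          using tendsto_pow_smul_sum_col hA hδ _ k))
    fun i => (hinit i).aemeasurable.add (hreversed.forall_aemeasurable i)
  refine hsum.congr (fun i => ?_) (ae_eq_refl _)
  filter_upwards [ae_likelihood_pos hL hξ hac] with ω hω
  exact (logBelief_eq A δ (hμ₀_pos ω) hω θ₀ k i).symm

theorem tendstoInDistribution_steadyLogBelief (hA : A ∈ Matrix.colStochastic ℝ (Fin N))
    (hprim : A.IsPrimitive) {π : Fin N → ℝ} (hπ : A.mulVec π = π) (hπ_sum : ∑ l, π l = 1)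
    (hL : ∀ k θ, Measurable (L k θ)) (k : Fin N) :
    TendstoInDistribution
      (fun (δ : Set.Ioo (0 : ℝ) 1) ω =>
        (√(δ : ℝ))⁻¹ • (steadyLogBelief A L θ₀ δ (fun j i => ξ j i ω) k - mAve ν L θ₀ π))
      (comap (fun δ : Set.Ioo (0 : ℝ) 1 => (δ : ℝ)) (𝓝 0))
      id (fun _ => P) (multivariateGaussian 0 ((1 / 2 : ℝ) • cAve ν L θ₀ π)) := by
  set z : ℕ → Ω → EuclideanSpace ℝ {θ : Fin H // θ ≠ θ₀} := fun m ω =>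
    pooledLogLik π L θ₀ fun l => ξ l m ω
  have hpool : ∀ a, Measurable (pooledLogLik a L θ₀) := measurable_pooledLogLik hL
  have hdata : ∀ i, AEMeasurable (fun ω l => ξ l i ω) P := fun i =>
    aemeasurable_pi_lambda _ fun l => (hξ l i).aemeasurable
  have hz : ∀ m, HasLaw (z m) (P.map (z 0)) P := fun m =>
    ⟨(hpool π).comp_aemeasurable (hdata m), ((IdentDistrib.pi
      (fun l => (hξ l m).identDistrib (hξ l 0)) (hagents m) (hagents 0)).comp (hpool π)).map_eq⟩
  have hind : iIndepFun z P := htime.comp (fun _ => pooledLogLik π L θ₀) fun _ => hpool π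
  have hzLp : MemLp (z 0) 2 P := memLp_pooledLogLik (fun l => hξ l 0) hvar π
  have hmean : ∫ x, x ∂P.map (z 0) = mAve ν L θ₀ π :=
    ((hz 0).integral_eq).symm.trans (integral_pooledLogLik (fun l => hξ l 0) hvar π)
  have hcov : covarianceBilin (multivariateGaussian 0 ((1 / 2 : ℝ) • cAve ν L θ₀ π))
      = (2⁻¹ : ℝ) • covarianceBilin (P.map (z 0)) := by
    rw [← one_div]
    exact covarianceBilin_multivariateGaussian_smul hzLp
      (covariance_pooledLogLik (fun l => hξ l 0) hvar (hagents 0) π) one_half_pos.le 0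
  have hclose : ∀ᵐ ω ∂P, Summable fun m =>
      ‖pooledLogLik ((A ^ (m + 1)).col k) L θ₀ (fun l => ξ l m ω) - z m ω‖ :=
    ae_summable_norm_pooledLogLik_sub hξ hvar hL fun l =>
      (summable_nat_add_iff 1).2 (summable_pow_apply_sub hprim hA hπ hπ_sum l k)
  have := Measure.isProbabilityMeasure_map (hz 0).aemeasurable
  rw [← hmean]
  exact tendstoInDistribution_abelMean hind hz
    ((memLp_map_measure_iff aestronglyMeasurable_id (hz 0).aemeasurable).2 hzLp)
    (fun δ => δ.2) tendsto_comap (fun m => (hpool _).comp_aemeasurable (hdata m)) hclose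
    (fun δ => ae_hasSum_steadyLogBelief hξ hvar hA δ.2 k) integral_id_multivariateGaussian hcov

end Dynamics

end Data

end ASL

theorem theorem3_general
    {N H : ℕ} (A : Matrix (Fin N) (Fin N) ℝ)
    (hA_conn : A.IsIrreducible) (hA_aper : ASL.IsAperiodic A)
    (hA_stoch : ∀ k, ∑ l, A l k = 1)
    (π : Fin N → ℝ) (hπ_eig : A.mulVec π = π) (hπ_sum : ∑ l, π l = 1)
    {X : Fin N → Type*} [∀ k, MeasurableSpace (X k)]
    (ν : ∀ k, Measure (X k))
    (L : ∀ k, Fin H → X k → ℝ)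
    (hL_meas : ∀ k θ, Measurable (L k θ))
    (θ₀ : Fin H)
    {Ω : Type*} [MeasurableSpace Ω] (P : Measure Ω) [IsProbabilityMeasure P]
    (ξ : ∀ k, ℕ → Ω → X k) (hξ : ∀ k i, HasLaw (ξ k i) (ASL.law (ν k) (L k θ₀)) P)
    (hξ_time : iIndepFun (fun (i : ℕ) (ω : Ω) (k : Fin N) => ξ k i ω) P)
    (hξ_agents : ∀ i, iIndepFun (fun (k : Fin N) => ξ k i) P)
    (μ₀ : Ω → Fin N → Fin H → ℝ) (hμ₀_meas : Measurable μ₀)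
    (hμ₀_pos : ∀ ω k θ, 0 < μ₀ ω k θ)
    (h_ac : ∀ k θ, θ ≠ θ₀ → ASL.law (ν k) (L k θ₀) ≪ ASL.law (ν k) (L k θ))
    (h_var : ∀ k θ, θ ≠ θ₀ →
      MemLp (ASL.logLik (L k) θ₀ θ) 2 (ASL.law (ν k) (L k θ₀)))
    (k : Fin N) :
    (∀ δ ∈ Set.Ioo (0 : ℝ) 1, ∀ θ, θ ≠ θ₀ → ∀ l, ∀ᵐ ω ∂P,
      Summable (ASL.steadyTerm A L θ₀ δ (fun j i => ξ j i ω) k θ l)) ∧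
    (∀ δ ∈ Set.Ioo (0 : ℝ) 1,
      TendstoInDistribution
        (fun (i : ℕ) ω => ASL.logBelief A L θ₀ δ (μ₀ ω) (fun j i => ξ j i ω) k i) atTop
        (fun ω => ASL.steadyLogBelief A L θ₀ δ (fun j i => ξ j i ω) k)
        (fun _ => P) P) ∧
    TendstoInDistribution
      (fun (δ : Set.Ioo (0 : ℝ) 1) ω =>
        (√(δ : ℝ))⁻¹ • (ASL.steadyLogBelief A L θ₀ δ (fun j i => ξ j i ω) k
          - ASL.mAve ν L θ₀ π))
      (comap (fun δ : Set.Ioo (0 : ℝ) 1 => (δ : ℝ)) (𝓝 0))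
      id (fun _ => P)
      (multivariateGaussian 0 ((1 / 2 : ℝ) • ASL.cAve ν L θ₀ π)) := by
  have hA : A ∈ Matrix.colStochastic ℝ (Fin N) :=
    Matrix.mem_colStochastic_iff_sum.2 ⟨hA_conn.nonneg, hA_stoch⟩
  have hprob : ∀ l, IsProbabilityMeasure (ASL.law (ν l) (L l θ₀)) := fun l =>
    (hξ l 0).isProbabilityMeasure_iff.1 inferInstance
  refine ⟨fun δ hδ θ hθ l => ?_, fun δ hδ => ?_, ?_⟩
  · exact ASL.ae_summable_steadyTerm hξ hA hδ ((h_var l θ hθ).integrable one_le_two) k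
  · exact ASL.tendstoInDistribution_logBelief hξ h_var hξ_time hξ_agents hA hL_meas h_ac hμ₀_meas
      hμ₀_pos hδ k
  · exact ASL.tendstoInDistribution_steadyLogBelief hξ h_var hξ_time hξ_agents hA
      (hA_aper.isPrimitive hA_conn) hπ_eig hπ_sum hL_meas k

theorem theorem3
    -- network, combination matrix and Perron eigenvector
    {N H : ℕ} (A : Matrix (Fin N) (Fin N) ℝ)
    (hA_conn : A.IsIrreducible) (hA_aper : ASL.IsAperiodic A)
    (hA_stoch : ∀ k, ∑ l, A l k = 1)
    (π : Fin N → ℝ) (hπ_eig : A.mulVec π = π) (hπ_sum : ∑ l, π l = 1) (hπ_pos : ∀ l, 0 < π l)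
    -- likelihoods: probability densities with respect to reference measures
    {X : Fin N → Type*} [∀ k, MeasurableSpace (X k)]
    (ν : ∀ k, Measure (X k)) [∀ k, SigmaFinite (ν k)]
    (L : ∀ k, Fin H → X k → ℝ)
    (hL_meas : ∀ k θ, Measurable (L k θ)) (hL_nonneg : ∀ k θ ξ, 0 ≤ L k θ ξ)
    (hL_prob : ∀ k θ, IsProbabilityMeasure (ASL.law (ν k) (L k θ)))
    (θ₀ : Fin H)
    -- data: `ξ k i` is the datum of agent `k` at time `i + 1`
    {Ω : Type*} [MeasurableSpace Ω] (P : Measure Ω) [IsProbabilityMeasure P]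
    (ξ : ∀ k, ℕ → Ω → X k) (hξ_meas : ∀ k i, Measurable (ξ k i))
    (hξ_law : ∀ k i, P.map (ξ k i) = ASL.law (ν k) (L k θ₀))
    (hξ_time : iIndepFun (fun (i : ℕ) (ω : Ω) (k : Fin N) => ξ k i ω) P)
    (hξ_agents : ∀ i, iIndepFun (fun (k : Fin N) => ξ k i) P)
    -- positive initial beliefs
    (μ₀ : Ω → Fin N → Fin H → ℝ) (hμ₀_meas : Measurable μ₀)
    (hμ₀_pos : ∀ ω k θ, 0 < μ₀ ω k θ) (hμ₀_sum : ∀ ω k, ∑ θ, μ₀ ω k θ = 1)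
    -- finiteness of the Kullback-Leibler divergences
    (h_kl : ∀ k θ, θ ≠ θ₀ →
      InformationTheory.klDiv (ASL.law (ν k) (L k θ₀)) (ASL.law (ν k) (L k θ)) ≠ ⊤)
    -- global identifiability
    (h_id : ∀ θ, θ ≠ θ₀ → ∃ k, 0 < ASL.meanLogLik (ν k) (L k) θ₀ θ)
    -- finite variance of the log-likelihood ratios
    (h_var : ∀ k θ, θ ≠ θ₀ →
      MemLp (ASL.logLik (L k) θ₀ θ) 2 (ASL.law (ν k) (L k θ₀)))
    (k : Fin N) :
    -- the series that define the steady-state log-belief ratios converge almost surely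
    (∀ δ ∈ Set.Ioo (0 : ℝ) 1, ∀ θ, θ ≠ θ₀ → ∀ l, ∀ᵐ ω ∂P,
      Summable (ASL.steadyTerm A L θ₀ δ (fun j i => ξ j i ω) k θ l)) ∧
    -- they are the steady state of the algorithm
    (∀ δ ∈ Set.Ioo (0 : ℝ) 1,
      TendstoInDistribution
        (fun (i : ℕ) ω => ASL.logBelief A L θ₀ δ (μ₀ ω) (fun j i => ξ j i ω) k i) atTop
        (fun ω => ASL.steadyLogBelief A L θ₀ δ (fun j i => ξ j i ω) k)
        (fun _ => P) P) ∧
    -- asymptotic normality as the step-size `δ ∈ (0, 1)` tends to `0`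
    TendstoInDistribution
      (fun (δ : Set.Ioo (0 : ℝ) 1) ω =>
        (√(δ : ℝ))⁻¹ • (ASL.steadyLogBelief A L θ₀ δ (fun j i => ξ j i ω) k
          - ASL.mAve ν L θ₀ π))
      (comap (fun δ : Set.Ioo (0 : ℝ) 1 => (δ : ℝ)) (𝓝 0))
      id (fun _ => P)
      (multivariateGaussian 0 ((1 / 2 : ℝ) • ASL.cAve ν L θ₀ π)) := by
  exact theorem3_general A hA_conn hA_aper hA_stoch π hπ_eig hπ_sum ν L hL_meas θ₀ P ξ
    (fun k i => ⟨(hξ_meas k i).aemeasurable, hξ_law k i⟩) hξ_time hξ_agents μ₀ hμ₀_meas hμ₀_pos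
    (fun k θ hθ => (InformationTheory.klDiv_ne_top_iff.1 (h_kl k θ hθ)).1) h_var k
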